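/- Let $e$ be a positive odd integer, let $q=2^e$ and $n=2^{(e-1)/2}+1$, and let $r\ge 2$. Let $\mathcal F^r_n$ be the Fermat hypersurface of $\mathrm{PG}(r,q^2)$ with equation $$X_0^n+X_1^n+\cdots+X_r^n=0,$$ and let $N$ be the number of its $\mathrm{GF}(q^2)$-rational points. For integers $Q\ge 2$ and $k\ge 0$ put $\theta_Q(k)=Q^k+Q^{k-1}+\cdots+1$, and put $\theta_Q(-1)=0$. Then: (i) if $e\equiv 1 \pmod 4$, then $N=\theta_{q^2}(r-1)$; (ii) if $e\equiv 3 \pmod 4$, then $N\le (n-1)q^{2(r-1)}+n\,q^{2(r-2)}+\theta_{q^2}(r-3)$; (iii) if $e=3$ and $r=2$, then $N=(q+1)^2$. -/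

import Mathlib

open MvPolynomial

/-- `projCard Q k` is `θ_Q(k) = Q^k + ⋯ + Q + 1`, the number of points of the `k`-dimensional
projective space over the field with `Q` elements, with `θ_Q(-1) = 0`. -/
def projCard (Q : ℕ) (k : ℤ) : ℕ :=
  ∑ i ∈ Finset.range (k + 1).toNat, Q ^ i

/-- The Fermat form `X_0 ^ n + X_1 ^ n + ⋯ + X_r ^ n`. -/
noncomputable def fermatForm (F : Type*) [Field F] (r n : ℕ) : MvPolynomial (Fin (r + 1)) F :=
  ∑ i : Fin (r + 1), X i ^ n

/-- The `F`-rational points, in the projective space of dimension `r` over `F`, of the hypersurface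
`f = 0`. It is used for homogeneous `f`, where the representative chosen for a point does not
matter. -/
def rationalPoints {F : Type*} [Field F] {r : ℕ} (f : MvPolynomial (Fin (r + 1)) F) :
    Set (Projectivization F (Fin (r + 1) → F)) :=
  {P | eval P.rep f = 0}

theorem fermatForm_isHomogeneous (F : Type*) [Field F] (r n : ℕ) :
    (fermatForm F r n).IsHomogeneous n := by
  refine IsHomogeneous.sum _ _ _ fun i _ => ?_
  simpa using (isHomogeneous_X F i).pow n

/-- The set of `F`-rational points of the Fermat hypersurface of degree `n` in the projective space
of dimension `r` over `F`. -/
noncomputable def fermatHypersurface (F : Type*) [Field F] (r n : ℕ) :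
    Set (Projectivization F (Fin (r + 1) → F)) :=
  rationalPoints (fermatForm F r n)

theorem mk_mem_fermatHypersurface_iff {F : Type*} [Field F] {r n : ℕ}
    (v : Fin (r + 1) → F) (hv : v ≠ 0) :
    Projectivization.mk F v hv ∈ fermatHypersurface F r n ↔ ∑ i, v i ^ n = 0 := by
  obtain ⟨a, ha⟩ := Projectivization.exists_smul_eq_mk_rep F v hv
  have h : eval (a • v) (fermatForm F r n) = (a : F) ^ n * ∑ i, v i ^ n := by
    simp [fermatForm, Units.smul_def, mul_pow, Finset.mul_sum]
  simp only [fermatHypersurface, rationalPoints, Set.mem_ofPred_eq, ← ha, h]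
  simp

/-! Write `Q = q^2` and `e = 2m+1`. The affine cone over the hypersurface consists of the origin and
`Q - 1` multiples of each rational point, so `N (Q - 1) + 1` is the number of zeros of the Fermat
form in affine space. Everything depends on `gcd(n, Q - 1)`, which divides 3 and is 1 for even `m`.

If `m` is even, `x ↦ x^n` permutes the field and the cone has exactly `Q^r` points. If `m ≥ 3` is
odd, its fibres have at most 3 elements, so the cone has at most `3 Q^r` points; as `n ≥ 9`, this
suffices.

The case `e = 3`, with cubes over the field of 64 elements, needs an exact count. The curve `x^3 +
y^3 = 1` is carried to `t^2 + t = c^3`, whose points are counted by a sum `S` of a quadratic-phase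
character: `S^2 = 256`, and a congruence mod 3 gives `S = 16` (`sum_artinSchreierChar_pow_three`).
Summing over a third variable gives (iii), and a slightly weaker uniform estimate gives (ii). -/

/-- The number of solutions of `x_1 ^ n + ⋯ + x_k ^ n = c` in `F`. -/
def powSumCount (F : Type*) [Field F] [Fintype F] [DecidableEq F] (n k : ℕ) (c : F) : ℕ :=
  (Finset.univ.filter fun v : Fin k → F => ∑ i, v i ^ n = c).card

/-! ### Affine solution counts and the cone. -/

section Counting

variable {F : Type*} [Field F] [Fintype F] [DecidableEq F]

theorem powSumCount_succ (n k : ℕ) (c : F) :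
    powSumCount F n (k + 1) c = ∑ x : F, powSumCount F n k (c - x ^ n) := by
  have h : powSumCount F n (k + 1) c =
      (Finset.univ.filter fun p : F × (Fin k → F) => ∑ i, p.2 i ^ n = c - p.1 ^ n).card := by
    symm
    refine Finset.card_equiv (Fin.consEquiv fun _ => F) fun p => ?_
    simp [Fin.consEquiv, Fin.sum_univ_succ, eq_sub_iff_add_eq']
  rw [h, Finset.card_filter, Fintype.sum_prod_type]
  exact Finset.sum_congr rfl fun x _ => (Finset.card_filter _ _).symm

theorem powSumCount_one (n : ℕ) (c : F) :
    powSumCount F n 1 c = (Finset.univ.filter fun x : F => x ^ n = c).card := by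
  refine Finset.card_equiv (Equiv.funUnique (Fin 1) F) fun p => ?_
  simp

theorem powSumCount_two (n : ℕ) (c : F) :
    powSumCount F n 2 c =
      (Finset.univ.filter fun p : F × F => p.1 ^ n + p.2 ^ n = c).card := by
  refine Finset.card_equiv (finTwoArrowEquiv F) fun p => ?_
  simp

/-- Each further variable only shifts `c`, so a bound uniform in `c` gains a factor `Fintype.card
F`. -/
theorem powSumCount_add_le {n k B : ℕ} (h : ∀ c : F, powSumCount F n k c ≤ B) (j : ℕ) (c : F) :
    powSumCount F n (k + j) c ≤ B * Fintype.card F ^ j := by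
  induction j generalizing c with
  | zero => simpa using h c
  | succ j ih =>
    rw [← add_assoc, powSumCount_succ]
    refine (Finset.sum_le_card_nsmul _ _ _ fun x _ => ih _).trans_eq ?_
    simp only [Finset.card_univ, smul_eq_mul]
    ring

theorem powSumCount_add_eq {n k B : ℕ} (h : ∀ c : F, powSumCount F n k c = B) (j : ℕ) (c : F) :
    powSumCount F n (k + j) c = B * Fintype.card F ^ j := by
  induction j generalizing c with
  | zero => simpa using h c
  | succ j ih =>
    rw [← add_assoc, powSumCount_succ, Finset.sum_congr rfl fun x _ => ih _]
    simp only [Finset.sum_const, Finset.card_univ, smul_eq_mul]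
    ring

theorem sum_powSumCount (n k : ℕ) :
    ∑ c : F, powSumCount F n k c = Fintype.card F ^ k := by
  have h := Finset.card_eq_sum_card_fiberwise (s := (Finset.univ : Finset (Fin k → F)))
    (t := (Finset.univ : Finset F)) (f := fun v => ∑ i, v i ^ n) (fun _ _ => by simp)
  simpa [powSumCount] using h.symm

/-- Counting the affine cone over a Fermat hypersurface. -/
theorem fermatHypersurface_ncard_mul_add_one (r : ℕ) {n : ℕ} (hn : n ≠ 0) :
    (fermatHypersurface F r n).ncard * (Fintype.card F - 1) + 1 =
      powSumCount F n (r + 1) (0 : F) := by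
  have hmem (P : fermatHypersurface F r n) (u : Fˣ) :
      u • P.1.rep ≠ 0 ∧ ∑ i, (u • P.1.rep) i ^ n = 0 := by
    have hne : u • P.1.rep ≠ 0 := (smul_ne_zero_iff_ne u).2 P.1.rep_nonzero
    refine ⟨hne, (mk_mem_fermatHypersurface_iff _ hne).1 ?_⟩
    have : Projectivization.mk F (u • P.1.rep) hne = P.1 := by
      conv_rhs => rw [← P.1.mk_rep]
      exact (Projectivization.mk_eq_mk_iff F _ _ _ _).2 ⟨u, rfl⟩
    rw [this]
    exact P.2
  let φ : fermatHypersurface F r n × Fˣ →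
      {v : Fin (r + 1) → F // v ≠ 0 ∧ ∑ i, v i ^ n = 0} :=
    fun p => ⟨p.2 • p.1.1.rep, hmem p.1 p.2⟩
  have hφ : Function.Bijective φ := by
    constructor
    · rintro ⟨P, u⟩ ⟨P', u'⟩ h
      have h' : u • P.1.rep = u' • P'.1.rep := congrArg Subtype.val h
      have hP : P = P' := by
        apply Subtype.ext
        rw [← P.1.mk_rep, ← P'.1.mk_rep]
        refine (Projectivization.mk_eq_mk_iff F _ _ _ _).2 ⟨u⁻¹ * u', ?_⟩
        rw [mul_smul, ← h', inv_smul_smul]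
      subst hP
      have : (u : F) = u' := smul_left_injective F P.1.rep_nonzero h'
      rw [Units.ext this]
    · rintro ⟨v, hv, hs⟩
      obtain ⟨a, ha⟩ := Projectivization.exists_smul_eq_mk_rep F v hv
      refine ⟨⟨⟨Projectivization.mk F v hv, (mk_mem_fermatHypersurface_iff v hv).2 hs⟩, a⁻¹⟩, ?_⟩
      apply Subtype.ext
      change a⁻¹ • (Projectivization.mk F v hv).rep = v
      rw [← ha, inv_smul_smul]
  have hc := Nat.card_congr (Equiv.ofBijective φ hφ)
  rw [Nat.card_prod, Nat.card_eq_fintype_card (α := Fˣ), Fintype.card_units] at hc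
  change (fermatHypersurface F r n).ncard * _ = _ at hc
  rw [hc, Nat.card_eq_fintype_card, Fintype.card_subtype, powSumCount]
  have h0 : (0 : Fin (r + 1) → F) ∈
      Finset.univ.filter fun v : Fin (r + 1) → F => ∑ i, v i ^ n = 0 := by simp [hn]
  rw [← Finset.card_erase_add_one h0]
  congr 2
  ext v
  simp

/-- Dividing by one nonzero solution embeds the fibre in the `k`-th roots of unity; over `c = 0`
only `0` remains. -/
theorem card_filter_pow_eq_le {n k : ℕ} (hn : n ≠ 0) (hk : 0 < k)
    (h : ∀ z : F, z ^ n = 1 → z ^ k = 1) (c : F) :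
    (Finset.univ.filter fun x : F => x ^ n = c).card ≤ k := by
  rcases (Finset.univ.filter fun x : F => x ^ n = c).eq_empty_or_nonempty with he | ⟨y, hy⟩
  · simp [he]
  rw [Finset.mem_filter] at hy
  obtain rfl | hy0 := eq_or_ne y 0
  · refine (Finset.card_le_one.2 fun a ha b hb => ?_).trans hk
    simp only [← hy.2, zero_pow hn, pow_eq_zero_iff hn, Finset.mem_filter] at ha hb
    rw [ha.2, hb.2]
  · calc _ ≤ (Polynomial.nthRoots k (1 : F)).toFinset.card := by
          refine Finset.card_le_card_of_injOn (fun x => x / y) (fun x hx => ?_) fun a _ b _ hab => ?_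
          · simp only [Finset.coe_filter, Finset.mem_univ, true_and, Set.mem_ofPred_eq] at hx
            simp only [SetLike.mem_coe, Multiset.mem_toFinset, Polynomial.mem_nthRoots hk]
            apply h
            rw [div_pow, hx, hy.2, div_self]
            rw [← hy.2]
            exact pow_ne_zero _ hy0
          · exact (div_left_inj' hy0).1 hab
      _ ≤ _ := Multiset.toFinset_card_le _
      _ ≤ k := Polynomial.card_nthRoots _ _

end Counting

/-! ### Arithmetic of the exponent and cube roots of unity. -/

/-- Since `m` and `2m+1` are coprime, `2^(2m) - 1` and `2^(2(2m+1)) - 1` have gcd `2^2 - 1`. -/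
theorem gcd_two_pow_add_one_dvd_three (m : ℕ) :
    Nat.gcd (2 ^ m + 1) (2 ^ (2 * (2 * m + 1)) - 1) ∣ 3 := by
  have h1 : 2 ^ m + 1 ∣ 2 ^ (2 * m) - 1 :=
    ⟨2 ^ m - 1, by rw [mul_comm 2 m, pow_mul, ← Nat.sq_sub_sq, one_pow]⟩
  have h2 := Nat.gcd_dvd_gcd_of_dvd_left (2 ^ (2 * (2 * m + 1)) - 1) h1
  rw [Nat.pow_sub_one_gcd_pow_sub_one, Nat.gcd_mul_left] at h2
  simpa using h2

theorem gcd_two_pow_add_one_of_even {m : ℕ} (hm : Even m) :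
    Nat.gcd (2 ^ m + 1) (2 ^ (2 * (2 * m + 1)) - 1) = 1 := by
  refine ((Nat.dvd_prime Nat.prime_three).1 (gcd_two_pow_add_one_dvd_three m)).resolve_right
    fun h => ?_
  have h3 : 3 ∣ 2 ^ m + 1 := h ▸ Nat.gcd_dvd_left _ _
  obtain ⟨k, rfl⟩ := hm
  have : 2 ^ (k + k) % 3 = 1 := by
    rw [← two_mul, pow_mul, Nat.pow_mod]
    simp
  omega

theorem projCard_mul_add_one (Q k : ℕ) :
    projCard (Q + 1) ((k : ℤ) - 1) * Q + 1 = (Q + 1) ^ k := by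
  simpa [projCard] using geom_sum_mul_add Q k

theorem pow_three_eq_one_iff_of_root {F : Type*} [Field F] {w : F} (hw : w ^ 2 + w + 1 = 0)
    (z : F) : z ^ 3 = 1 ↔ z = 1 ∨ z = w ∨ z = w ^ 2 := by
  have : z ^ 3 - 1 = (z - 1) * ((z - w) * (z - w ^ 2)) := by
    linear_combination (z - 1) * (z - (w - 1)) * hw
  rw [← sub_eq_zero, this, mul_eq_zero, mul_eq_zero, sub_eq_zero, sub_eq_zero, sub_eq_zero]

theorem charP_two_of_card_eq_two_pow {F : Type*} [Field F] [Fintype F] {k : ℕ}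
    (hF : Fintype.card F = 2 ^ k) : CharP F 2 := by
  have h := FiniteField.cast_card_eq_zero F
  rw [hF] at h
  push_cast at h
  exact CharTwo.of_one_ne_zero_of_two_eq_zero one_ne_zero (eq_zero_of_pow_eq_zero h)

theorem exists_sq_add_self_add_one_eq_zero {F : Type*} [Field F] [Fintype F]
    (h3 : 3 ∣ Fintype.card F - 1) : ∃ w : F, w ^ 2 + w + 1 = 0 := by
  classical
  have : Fact (Nat.Prime 3) := ⟨Nat.prime_three⟩
  obtain ⟨u, hu⟩ := exists_prime_orderOf_dvd_card (G := Fˣ) 3 (by rwa [Fintype.card_units])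
  have hu3 : (u : F) ^ 3 = 1 := by
    rw [← Units.val_pow_eq_pow_val, ← hu, pow_orderOf_eq_one, Units.val_one]
  have hu1 : (u : F) - 1 ≠ 0 := fun h => by
    have : u = 1 := Units.ext (by simpa using sub_eq_zero.1 h)
    simp [this] at hu
  refine ⟨u, mul_left_cancel₀ hu1 ?_⟩
  linear_combination hu3

/-! ### The Artin–Schreier character and its cubic sum. -/

section ArtinSchreier

variable (F : Type*) [Field F] [CharP F 2]

/-- The additive map `t ↦ t ^ 2 + t` in characteristic two. -/
def artinSchreierHom : F →+ F where
  toFun t := t ^ 2 + t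
  map_zero' := by simp
  map_add' x y := by rw [CharTwo.add_sq]; ring

theorem artinSchreierHom_apply (t : F) : artinSchreierHom F t = t ^ 2 + t := rfl

theorem mem_ker_artinSchreierHom {t : F} : t ∈ (artinSchreierHom F).ker ↔ t = 0 ∨ t = 1 := by
  rw [AddMonoidHom.mem_ker, artinSchreierHom_apply, pow_two, ← mul_add_one, mul_eq_zero,
    add_eq_zero_iff_eq_neg, CharTwo.neg_eq]

theorem index_range_artinSchreierHom [Finite F] : (artinSchreierHom F).range.index = 2 := by
  have hk : Nat.card (artinSchreierHom F).ker = 2 := by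
    have : ((artinSchreierHom F).ker : Set F) = {0, 1} := by
      ext t
      exact mem_ker_artinSchreierHom F
    change Nat.card ((artinSchreierHom F).ker : Set F) = 2
    rw [this, Nat.card_coe_set_eq, Set.ncard_pair zero_ne_one]
  have h1 := (artinSchreierHom F).ker.card_mul_index
  have h2 := (artinSchreierHom F).range.card_mul_index
  rw [AddSubgroup.index_ker, hk, ← h2, mul_comm] at h1
  exact (Nat.eq_of_mul_eq_mul_left Nat.card_pos h1).symm

open Classical in
/-- The nontrivial additive character whose kernel is the set of all `t ^ 2 + t`. -/
noncomputable def artinSchreierChar [Finite F] : AddChar F ℤ where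
  toFun y := if y ∈ (artinSchreierHom F).range then 1 else -1
  map_zero_eq_one' := if_pos (zero_mem _)
  map_add_eq_mul' x y := by
    have := AddSubgroup.add_mem_iff_of_index_two (index_range_artinSchreierHom F) (a := x) (b := y)
    by_cases hx : x ∈ (artinSchreierHom F).range <;>
      by_cases hy : y ∈ (artinSchreierHom F).range <;> simp [this, hx, hy]

open Classical in
theorem artinSchreierChar_apply [Finite F] (y : F) :
    artinSchreierChar F y = if y ∈ (artinSchreierHom F).range then 1 else -1 := rfl

theorem artinSchreierChar_sq_add_self [Finite F] (t : F) :
    artinSchreierChar F (t ^ 2 + t) = 1 :=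
  if_pos ⟨t, rfl⟩

theorem artinSchreierChar_sq [Finite F] (t : F) :
    artinSchreierChar F (t ^ 2) = artinSchreierChar F t := by
  have h : t ^ 2 = (t ^ 2 + t) + t := by rw [add_assoc, CharTwo.add_self_eq_zero, add_zero]
  rw [h, AddChar.map_add_eq_mul, artinSchreierChar_sq_add_self, one_mul]

theorem artinSchreierChar_ne_one [Finite F] : artinSchreierChar F ≠ 1 := by
  intro h
  have htop : (artinSchreierHom F).range = ⊤ := by
    refine eq_top_iff.2 fun y _ => ?_
    by_contra hy
    have := DFunLike.congr_fun h y
    rw [artinSchreierChar_apply, if_neg hy] at this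
    norm_num at this
  have := index_range_artinSchreierHom F
  rw [htop, AddSubgroup.index_top] at this
  norm_num at this

theorem card_filter_sq_add_self_eq [Fintype F] [DecidableEq F] (y : F) :
    ((Finset.univ.filter fun t : F => t ^ 2 + t = y).card : ℤ) = 1 + artinSchreierChar F y := by
  rw [artinSchreierChar_apply]
  split_ifs with h
  · obtain ⟨s, rfl⟩ := h
    have : (Finset.univ.filter fun t : F => t ^ 2 + t = artinSchreierHom F s) = {s, s + 1} := by
      ext t
      simp only [Finset.mem_filter, Finset.mem_univ, true_and, Finset.mem_insert,
        Finset.mem_singleton]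
      rw [← artinSchreierHom_apply, ← sub_eq_zero, ← map_sub, ← AddMonoidHom.mem_ker,
        mem_ker_artinSchreierHom, sub_eq_zero, sub_eq_iff_eq_add']
    rw [this, Finset.card_pair (by simp)]
    norm_num
  · rw [Finset.filter_false_of_mem]
    · simp
    · exact fun t _ ht => h ⟨t, ht⟩

variable {F} [Fintype F] [DecidableEq F]

theorem sum_artinSchreierChar_sq_mul (b : F) :
    ∑ x : F, artinSchreierChar F (x ^ 2 * b) = if b = 0 then (Fintype.card F : ℤ) else 0 := by
  have h := AddChar.sum_mulShift b
    (AddChar.IsPrimitive.of_ne_one (artinSchreierChar_ne_one F))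
  rw [← Equiv.sum_comp (frobeniusEquiv F 2).toEquiv] at h
  simpa [frobenius_def] using h

/-- Put `y = x + h` in the double sum: the cubes of `x` cancel, and Frobenius invariance turns `x
h^2` into `x^2 h^4`. The phase is then additive in `x`, so only `h + h^4 = 0` survives
orthogonality; there `h^3` is 0 or `1 = w^2 + w`, of character value 1. -/
theorem sq_sum_artinSchreierChar_pow_three {w : F} (hw : w ^ 2 + w + 1 = 0) :
    (∑ c : F, artinSchreierChar F (c ^ 3)) ^ 2 =
      Fintype.card F * (Finset.univ.filter fun h : F => h + h ^ 4 = 0).card := by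
  have key (x h : F) : artinSchreierChar F (x ^ 3) * artinSchreierChar F ((x + h) ^ 3) =
      artinSchreierChar F (h ^ 3) * artinSchreierChar F (x ^ 2 * (h + h ^ 4)) := by
    have e1 : x ^ 3 + (x + h) ^ 3 = h ^ 3 + (x ^ 2 * h + x * h ^ 2) := by
      linear_combination (x ^ 3 + x ^ 2 * h + x * h ^ 2) * CharTwo.two_eq_zero (R := F)
    rw [← AddChar.map_add_eq_mul, e1, AddChar.map_add_eq_mul, AddChar.map_add_eq_mul, mul_add,
      AddChar.map_add_eq_mul, ← artinSchreierChar_sq F (x * h ^ 2)]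
    ring_nf
  calc (∑ c : F, artinSchreierChar F (c ^ 3)) ^ 2
      = ∑ x : F, ∑ h : F,
          artinSchreierChar F (x ^ 3) * artinSchreierChar F ((x + h) ^ 3) := by
        rw [sq, Finset.sum_mul_sum]
        exact Finset.sum_congr rfl fun x _ => (Equiv.sum_comp (Equiv.addLeft x) fun y =>
          artinSchreierChar F (x ^ 3) * artinSchreierChar F (y ^ 3)).symm
    _ = ∑ h : F, if h + h ^ 4 = 0 then (Fintype.card F : ℤ) else 0 := by
        rw [Finset.sum_comm]
        refine Finset.sum_congr rfl fun h _ => ?_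
        simp_rw [key, ← Finset.mul_sum, sum_artinSchreierChar_sq_mul]
        split_ifs with h4
        · have h3 : h = 0 ∨ h ^ 3 = 1 := by
            have : h * (1 + h ^ 3) = 0 := by linear_combination h4
            rw [mul_eq_zero, add_eq_zero_iff_neg_eq, CharTwo.neg_eq] at this
            exact this.imp id Eq.symm
          have : artinSchreierChar F (h ^ 3) = 1 := by
            obtain rfl | h3 := h3
            · simp
            · have h1 : w ^ 2 + w = 1 := by
                rw [← CharTwo.neg_eq (1 : F)]
                linear_combination hw
              rw [h3, ← h1, artinSchreierChar_sq_add_self]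
          rw [this, one_mul]
        · simp
    _ = _ := by
        rw [← Finset.sum_filter, Finset.sum_const, nsmul_eq_mul, mul_comm]

end ArtinSchreier

/-! ### Sums of cubes in characteristic two. -/

section Cubes

variable {F : Type*} [Field F] [CharP F 2] [Fintype F] [DecidableEq F]

theorem card_filter_pow_three_eq_pow_three {w : F} (hw : w ^ 2 + w + 1 = 0) {y : F} (hy : y ≠ 0) :
    (Finset.univ.filter fun x : F => x ^ 3 = y ^ 3).card = 3 := by
  have hw0 : w ≠ 0 := by rintro rfl; simp at hw
  have hw1 : w ≠ 1 := by
    rintro rfl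
    exact one_ne_zero (α := F) (by linear_combination hw - CharTwo.two_eq_zero (R := F))
  have hw2 : w ^ 2 ≠ 1 := fun h => hw0 (by
    linear_combination hw - h - CharTwo.two_eq_zero (R := F))
  have hw3 : w ≠ w ^ 2 := fun h => hw1 (mul_left_cancel₀ hw0 (by linear_combination -h))
  have : (Finset.univ.filter fun x : F => x ^ 3 = y ^ 3) =
      ({1, w, w ^ 2} : Finset F).image (· * y) := by
    ext x
    have h3 : x ^ 3 = y ^ 3 ↔ (x / y) ^ 3 = 1 := by
      rw [div_pow, div_eq_one_iff_eq (pow_ne_zero _ hy)]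
    simp only [Finset.mem_filter, Finset.mem_univ, true_and, h3, pow_three_eq_one_iff_of_root hw,
      div_eq_iff hy, Finset.mem_image, Finset.mem_insert, Finset.mem_singleton,
      exists_eq_or_imp, exists_eq_left, @eq_comm F _ x]
  rw [this, Finset.card_image_of_injective _ (mul_left_injective₀ hy)]
  exact Finset.card_eq_three.2 ⟨1, w, w ^ 2, hw1.symm, hw2.symm, hw3, rfl⟩

variable (F) in
/-- The set of nonzero cubes. -/
def nonzeroCubes : Finset F := (Finset.univ.erase 0).image (· ^ 3)

omit [CharP F 2] in
theorem mem_nonzeroCubes {c : F} : c ∈ nonzeroCubes F ↔ ∃ x : F, x ≠ 0 ∧ x ^ 3 = c := by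
  simp [nonzeroCubes]

theorem sum_pow_three {M : Type*} [AddCommMonoid M] {w : F} (hw : w ^ 2 + w + 1 = 0) (f : F → M) :
    ∑ x : F, f (x ^ 3) = f 0 + 3 • ∑ y ∈ nonzeroCubes F, f y := by
  rw [← Finset.add_sum_erase _ _ (Finset.mem_univ (0 : F)), zero_pow three_ne_zero,
    Finset.sum_comp f (· ^ 3), nonzeroCubes, ← Finset.sum_nsmul]
  congr 1
  refine Finset.sum_congr rfl fun c hc => ?_
  obtain ⟨y, hy, rfl⟩ := mem_nonzeroCubes.1 hc
  refine congrArg (· • f (y ^ 3)) ((congrArg Finset.card (Finset.ext fun x => ?_)).trans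
    (card_filter_pow_three_eq_pow_three hw hy))
  simp only [Finset.mem_filter, Finset.mem_erase, Finset.mem_univ, and_true, true_and,
    and_iff_right_iff_imp]
  rintro h rfl
  exact hy (by simpa using h.symm)

theorem card_nonzeroCubes {w : F} (hw : w ^ 2 + w + 1 = 0) :
    Fintype.card F = 1 + 3 * (nonzeroCubes F).card := by
  simpa [Finset.sum_const] using sum_pow_three hw fun _ => (1 : ℕ)

theorem powSumCount_two_zero {w : F} (hw : w ^ 2 + w + 1 = 0) :
    powSumCount F 3 2 (0 : F) = 1 + 3 * (Fintype.card F - 1) := by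
  rw [powSumCount_succ, ← Finset.add_sum_erase _ _ (Finset.mem_univ (0 : F)),
    Finset.sum_congr rfl (g := fun _ => 3) fun x hx => ?_]
  · simp [powSumCount_one, Finset.card_erase_of_mem, mul_comm, Finset.filter_eq']
  · rw [powSumCount_one, zero_sub, CharTwo.neg_eq]
    exact card_filter_pow_three_eq_pow_three hw (Finset.ne_of_mem_erase hx)

theorem powSumCount_pow_mul {G : Type*} [Field G] [Fintype G] [DecidableEq G] (n k : ℕ) {d : G}
    (hd : d ≠ 0) (c : G) :
    powSumCount G n k (d ^ n * c) = powSumCount G n k c := by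
  symm
  refine Finset.card_equiv (Equiv.piCongrRight fun _ => Equiv.mulLeft₀ d hd) fun v => ?_
  simp [mul_pow, ← Finset.mul_sum, hd]

/-- The curves `x ^ 3 + y ^ 3 = 1` and `t ^ 2 + t = c ^ 3` are isomorphic away from `c = 0`. -/
theorem powSumCount_two_one {w : F} (hw : w ^ 2 + w + 1 = 0) :
    powSumCount F 3 2 (1 : F) =
      (Finset.univ.filter fun p : F × F => p.1 ^ 2 + p.1 = p.2 ^ 3 ∧ p.2 ≠ 0).card := by
  have h2 := CharTwo.two_eq_zero (R := F)
  rw [powSumCount_two]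
  symm
  have hinv (c : F) (hc : c ≠ 0) (t : F) : (t + w ^ 2) / c + (t + w) / c = 1 / c := by
    rw [← add_div]
    congr 1
    linear_combination hw + (t - 1) * h2
  -- Because `w + w^2 = 1`, the coordinates satisfy `x + y = 1 / c`, which recovers `c` and then
  -- `t`.
  refine Finset.card_bij' (fun p _ => ((p.1 + w ^ 2) / p.2, (p.1 + w) / p.2))
    (fun p _ => (p.1 / (p.1 + p.2) + w ^ 2, 1 / (p.1 + p.2))) ?_ ?_ ?_ ?_
  · rintro ⟨t, c⟩ h
    simp only [Finset.mem_filter, Finset.mem_univ, true_and] at h ⊢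
    rw [div_pow, div_pow, ← add_div, div_eq_one_iff_eq (pow_ne_zero _ h.2), ← h.1]
    linear_combination (3 * t ^ 2 + 3 * t * (w ^ 2 - w + 1) + (w - 1) * (w ^ 3 + 2)) * hw +
      (t ^ 3 - 2 * t ^ 2 - 2 * t + 1) * h2
  · rintro ⟨x, y⟩ h
    simp only [Finset.mem_filter, Finset.mem_univ, true_and] at h ⊢
    have hxy : x + y ≠ 0 := fun h0 => one_ne_zero (α := F) (by
      rw [← h]; linear_combination (x ^ 2 - x * y + y ^ 2) * h0)
    refine ⟨?_, one_div_ne_zero hxy⟩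
    rw [one_div_pow]
    field_simp
    linear_combination (w ^ 2 - w + 1) * (x + y) ^ 3 * hw +
      (w ^ 2 * x * (x + y) ^ 2 - (x + y) * y ^ 2) * h2 + h
  · rintro ⟨t, c⟩ h
    simp only [Finset.mem_filter, Finset.mem_univ, true_and] at h
    have hc := h.2
    simp only [hinv c hc]
    refine Prod.ext ?_ (by simp)
    simp only [div_div_div_cancel_right₀ hc, div_one]
    linear_combination w ^ 2 * h2
  · rintro ⟨x, y⟩ h
    simp only [Finset.mem_filter, Finset.mem_univ, true_and] at h
    have hxy : x + y ≠ 0 := fun h0 => one_ne_zero (α := F) (by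
      rw [← h]; linear_combination (x ^ 2 - x * y + y ^ 2) * h0)
    refine Prod.ext ?_ ?_
    · field_simp
      linear_combination w ^ 2 * (x + y) * h2
    · field_simp
      linear_combination (x + y) * hw - y * h2

/-- Each `c` carries `1 + χ(c^3)` values of `t`; the 2 restores the excluded `c = 0`. -/
theorem card_filter_sq_add_self_eq_pow_three :
    ((Finset.univ.filter fun p : F × F => p.1 ^ 2 + p.1 = p.2 ^ 3 ∧ p.2 ≠ 0).card : ℤ) + 2 =
      Fintype.card F + ∑ c : F, artinSchreierChar F (c ^ 3) := by
  have h (c : F) : ((Finset.univ.filter fun t : F => t ^ 2 + t = c ^ 3 ∧ c ≠ 0).card : ℤ) =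
      if c = 0 then 0 else 1 + artinSchreierChar F (c ^ 3) := by
    split_ifs with hc
    · simp [hc]
    · simp [hc, ← card_filter_sq_add_self_eq]
  have h' : Fintype.card F + ∑ c : F, artinSchreierChar F (c ^ 3) =
      ∑ c : F, (1 + artinSchreierChar F (c ^ 3)) := by
    simp [Finset.sum_add_distrib]
  rw [h', Finset.card_filter, Fintype.sum_prod_type_right]
  simp_rw [← Finset.card_filter]
  push_cast
  simp_rw [h]
  rw [← Finset.add_sum_erase _ _ (Finset.mem_univ (0 : F)),
    ← Finset.add_sum_erase (a := (0 : F)) (f := fun c => 1 + artinSchreierChar F (c ^ 3)) _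
      (Finset.mem_univ _),
    Finset.sum_congr rfl fun c hc => if_neg (Finset.ne_of_mem_erase hc)]
  simp

theorem card_filter_add_pow_four {w : F} (hw : w ^ 2 + w + 1 = 0) :
    (Finset.univ.filter fun h : F => h + h ^ 4 = 0).card = 4 := by
  have : (Finset.univ.filter fun h : F => h + h ^ 4 = 0) =
      insert 0 (Finset.univ.filter fun h : F => h ^ 3 = 1 ^ 3) := by
    ext h
    have : h + h ^ 4 = h * (1 + h ^ 3) := by ring
    have h1 : 1 + h ^ 3 = 0 ↔ h ^ 3 = 1 := by
      rw [add_eq_zero_iff_neg_eq, CharTwo.neg_eq, eq_comm]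
    simp [this, h1]
  rw [this, Finset.card_insert_of_notMem (by simp),
    card_filter_pow_three_eq_pow_three hw one_ne_zero]

theorem sum_artinSchreierChar_pow_three (hF : Fintype.card F = 64) {w : F}
    (hw : w ^ 2 + w + 1 = 0) :
    ∑ c : F, artinSchreierChar F (c ^ 3) = 16 := by
  have h1 := sq_sum_artinSchreierChar_pow_three hw
  have h2 := sum_pow_three hw fun c => artinSchreierChar F c
  rw [card_filter_add_pow_four hw, hF] at h1
  rw [AddChar.map_zero_eq_one, nsmul_eq_mul] at h2
  generalize ∑ c : F, artinSchreierChar F (c ^ 3) = S at *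
  have h3 : (S - 16) * (S + 16) = 0 := by linear_combination h1
  -- By `h2`, `S` is 1 mod 3, which excludes `-16`.
  rcases mul_eq_zero.1 h3 with h | h <;> push_cast at h2 <;> omega

theorem powSumCount_two_of_mem_nonzeroCubes (hF : Fintype.card F = 64) {w : F}
    (hw : w ^ 2 + w + 1 = 0) {c : F} (hc : c ∈ nonzeroCubes F) :
    powSumCount F 3 2 c = 78 := by
  obtain ⟨d, hd, rfl⟩ := mem_nonzeroCubes.1 hc
  have h := card_filter_sq_add_self_eq_pow_three (F := F)
  rw [← mul_one (d ^ 3), powSumCount_pow_mul 3 2 hd, powSumCount_two_one hw]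
  rw [sum_artinSchreierChar_pow_three hF hw, hF] at h
  push_cast at h
  omega

/-- The count is constant on cosets of the cubes. Of the 4096 pairs, 190 have sum 0 and 21 · 78 have
a nonzero cube as sum, leaving 2268 = 21 · 108 for the coset of a noncube. -/
theorem powSumCount_two_le (hF : Fintype.card F = 64) {w : F} (hw : w ^ 2 + w + 1 = 0) {c : F}
    (hc : c ≠ 0) : powSumCount F 3 2 c ≤ 108 := by
  by_cases hcube : c ∈ nonzeroCubes F
  · rw [powSumCount_two_of_mem_nonzeroCubes hF hw hcube]
    norm_num
  have hcard := card_nonzeroCubes hw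
  have hsum := sum_powSumCount (F := F) 3 2
  have hzero := powSumCount_two_zero hw
  rw [hF] at hcard hsum hzero
  set D := (nonzeroCubes F).image (· * c) with hD
  have hDcard : D.card = (nonzeroCubes F).card :=
    Finset.card_image_of_injective _ (mul_left_injective₀ hc)
  have hdisj : Disjoint (nonzeroCubes F) D := by
    rw [Finset.disjoint_right]
    rintro _ hx hx'
    obtain ⟨_, ha, rfl⟩ := Finset.mem_image.1 hx
    obtain ⟨a, ha0, rfl⟩ := mem_nonzeroCubes.1 ha
    obtain ⟨b, hb, h⟩ := mem_nonzeroCubes.1 hx'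
    refine hcube (mem_nonzeroCubes.2 ⟨b / a, div_ne_zero hb ha0, ?_⟩)
    rw [div_pow, h, mul_div_cancel_left₀ _ (pow_ne_zero _ ha0)]
  have h0 : (0 : F) ∉ nonzeroCubes F ∪ D := by
    simp only [hD, Finset.mem_union, Finset.mem_image, mem_nonzeroCubes]
    rintro (⟨x, hx, h⟩ | ⟨_, ⟨x, hx, rfl⟩, h⟩)
    · exact hx (by simpa using h)
    · exact mul_ne_zero (pow_ne_zero _ hx) hc h
  have hle := Finset.sum_le_sum_of_subset (f := fun c : F => powSumCount F 3 2 c)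
    (Finset.subset_univ (insert 0 (nonzeroCubes F ∪ D)))
  rw [Finset.sum_insert h0, Finset.sum_union hdisj,
    Finset.sum_congr rfl fun x hx => powSumCount_two_of_mem_nonzeroCubes hF hw hx,
    Finset.sum_congr (s₁ := D) (g := fun _ => powSumCount F 3 2 c) rfl fun x hx => ?_, hsum,
    Finset.sum_const, Finset.sum_const, hDcard, hzero, smul_eq_mul, smul_eq_mul] at hle
  · have : (nonzeroCubes F).card = 21 := by omega
    rw [this] at hle
    omega
  · obtain ⟨_, ha, rfl⟩ := Finset.mem_image.1 hx
    obtain ⟨a, ha0, rfl⟩ := mem_nonzeroCubes.1 ha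
    exact powSumCount_pow_mul 3 2 ha0 c

theorem powSumCount_three_le (hF : Fintype.card F = 64) {w : F} (hw : w ^ 2 + w + 1 = 0) (c : F) :
    powSumCount F 3 3 c ≤ 2 * 64 ^ 2 := by
  have hfib : (Finset.univ.filter fun x : F => x ^ 3 = c).card ≤ 3 :=
    card_filter_pow_eq_le three_ne_zero three_pos (fun _ h => h) c
  have hzero := powSumCount_two_zero hw
  rw [hF] at hzero
  calc powSumCount F 3 3 c = ∑ x : F, powSumCount F 3 2 (c - x ^ 3) := powSumCount_succ 3 2 c
    -- At `x^3 = c` the count is 190 = 108 + 82.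
    _ ≤ ∑ x : F, (108 + if x ^ 3 = c then 82 else 0) := by
        refine Finset.sum_le_sum fun x _ => ?_
        split_ifs with h
        · simp [h, hzero]
        · exact powSumCount_two_le hF hw (sub_ne_zero.2 (Ne.symm h))
    _ ≤ 64 * 108 + 3 * 82 := by
        rw [Finset.sum_add_distrib, ← Finset.sum_filter]
        simp only [Finset.sum_const, Finset.card_univ, hF, smul_eq_mul]
        omega
    _ ≤ _ := by norm_num

theorem powSumCount_three_zero (hF : Fintype.card F = 64) {w : F} (hw : w ^ 2 + w + 1 = 0) :
    powSumCount F 3 3 (0 : F) = 5104 := by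
  have hcard := card_nonzeroCubes hw
  have hzero := powSumCount_two_zero hw
  rw [hF] at hcard hzero
  have : (nonzeroCubes F).card = 21 := by omega
  rw [powSumCount_succ]
  simp_rw [zero_sub, CharTwo.neg_eq]
  rw [sum_pow_three hw, hzero,
    Finset.sum_congr rfl fun x hx => powSumCount_two_of_mem_nonzeroCubes hF hw hx]
  simp [this]

end Cubes

theorem mainTheorem11 (e r q n : ℕ) (he : Odd e) (hr : 2 ≤ r) (hq : q = 2 ^ e)
    (hn : n = 2 ^ ((e - 1) / 2) + 1)
    (F : Type*) [Field F] [Finite F] (hF : Nat.card F = q ^ 2) :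
    (e ≡ 1 [MOD 4] →
      (fermatHypersurface F r n).ncard = projCard (q ^ 2) ((r : ℤ) - 1)) ∧
    (e ≡ 3 [MOD 4] →
      (fermatHypersurface F r n).ncard ≤
        (n - 1) * q ^ (2 * (r - 1)) + n * q ^ (2 * (r - 2)) + projCard (q ^ 2) ((r : ℤ) - 3)) ∧
    (e = 3 → r = 2 → (fermatHypersurface F r n).ncard = (q + 1) ^ 2) := by
  classical
  have := Fintype.ofFinite F
  rw [Nat.card_eq_fintype_card] at hF
  obtain ⟨m, rfl⟩ := he
  have hm : (2 * m + 1 - 1) / 2 = m := by omega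
  rw [hm] at hn
  have hn0 : n ≠ 0 := by rw [hn]; exact Nat.succ_ne_zero _
  have hcone := fermatHypersurface_ncard_mul_add_one (F := F) r hn0
  have hQ : q ^ 2 = 2 ^ (2 * (2 * m + 1)) := by rw [hq, ← pow_mul, mul_comm]
  have hQ4 : 4 ≤ q ^ 2 := by
    rw [hQ]
    exact Nat.pow_le_pow_right (n := 2) (by norm_num) (show 2 ≤ 2 * (2 * m + 1) by omega)
  have hroot (k : ℕ) (hk : Nat.gcd n (q ^ 2 - 1) ∣ k) (z : F) (hz : z ^ n = 1) : z ^ k = 1 := by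
    have hz0 : z ≠ 0 := by
      rintro rfl
      simp [hn0] at hz
    have h1 : z ^ (q ^ 2 - 1) = 1 := hF ▸ FiniteField.pow_card_sub_one_eq_one z hz0
    obtain ⟨j, rfl⟩ := hk
    rw [pow_mul, pow_gcd_eq_one.2 ⟨hz, h1⟩, one_pow]
  have hroot3 : ∀ z : F, z ^ n = 1 → z ^ 3 = 1 :=
    hroot 3 (by rw [hn, hQ]; exact gcd_two_pow_add_one_dvd_three m)
  have hsmall (he3 : 2 * m + 1 = 3) : n = 3 ∧ q = 8 ∧ Fintype.card F = 64 := by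
    obtain rfl : m = 1 := by omega
    norm_num at hn hq
    exact ⟨hn, hq, by rw [hF, hq]; norm_num⟩
  rw [hF] at hcone
  refine ⟨fun he => ?_, fun he => ?_, fun he hr2 => ?_⟩
  · have hme : Even m := by
      rw [Nat.even_iff]
      unfold Nat.ModEq at he
      omega
    have hone (c : F) : powSumCount F n 1 c = 1 := by
      have hle (c : F) : powSumCount F n 1 c ≤ 1 := by
        rw [powSumCount_one]
        refine card_filter_pow_eq_le hn0 one_pos (hroot 1 ?_) c
        rw [hn, hQ, gcd_two_pow_add_one_of_even hme]
      have hsum : ∑ c : F, powSumCount F n 1 c = ∑ _c : F, 1 := by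
        simp [sum_powSumCount]
      exact (Finset.sum_eq_sum_iff_of_le fun c _ => hle c).1 hsum c (Finset.mem_univ c)
    have hcount := powSumCount_add_eq hone r 0
    rw [add_comm 1 r, ← hcone, one_mul, hF] at hcount
    obtain ⟨Q, hQ'⟩ : ∃ Q, q ^ 2 = Q + 1 := ⟨q ^ 2 - 1, by omega⟩
    have hproj := projCard_mul_add_one Q r
    rw [hQ', Nat.add_sub_cancel] at hcount
    rw [hQ']
    exact Nat.eq_of_mul_eq_mul_right (show 0 < Q by omega) (by omega)
  · obtain ⟨s, rfl⟩ : ∃ s, r = s + 2 := ⟨r - 2, by omega⟩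
    have hs1 : s + 2 - 1 = s + 1 := by omega
    rw [hs1, Nat.add_sub_cancel, pow_mul, pow_mul]
    refine le_trans ?_ (Nat.le_add_right _ _)
    obtain ⟨Q, hQ'⟩ : ∃ Q, q ^ 2 = Q + 1 := ⟨q ^ 2 - 1, by omega⟩
    rw [hQ', Nat.add_sub_cancel] at hcone
    rw [hQ'] at hF hQ4 ⊢
    generalize (fermatHypersurface F (s + 2) n).ncard = N at *
    have hQ0 : 0 < Q := by omega
    refine Nat.le_of_mul_le_mul_right ?_ hQ0
    have hP : 0 < (Q + 1) ^ s := by positivity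
    by_cases hm1 : m = 1
    · obtain ⟨rfl, -, h64⟩ := hsmall (by omega)
      have := charP_two_of_card_eq_two_pow (F := F) (k := 6) (by rw [h64]; norm_num)
      obtain ⟨w, hw⟩ := exists_sq_add_self_add_one_eq_zero (F := F) (by rw [h64]; norm_num)
      -- Fibres of size 3 would be too weak for `n = 3`; the bound `2 * 64 ^ 2 = 8192` fits under (2
      -- · 64 + 3) · 63 = 8253.
      have hle := powSumCount_add_le (powSumCount_three_le h64 hw) s 0
      rw [show 3 + s = s + 2 + 1 by ring, h64] at hle
      obtain rfl : Q = 63 := by omega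
      rw [pow_succ]
      norm_num at *
      omega
    -- `m` is odd and not 1, hence at least 3.
    · have hn9 : 9 ≤ n := by
        unfold Nat.ModEq at he
        have : 2 ^ 3 ≤ 2 ^ m := Nat.pow_le_pow_right (by norm_num) (by omega)
        omega
      have hle := powSumCount_add_le (n := n) (k := 1) (B := 3)
        (fun c : F => by
          rw [powSumCount_one]
          exact card_filter_pow_eq_le hn0 three_pos hroot3 c) (s + 2) 0
      rw [add_comm 1, ← hcone, hF] at hle
      calc N * Q ≤ 3 * (Q + 1) * (Q + 1) ^ (s + 1) := by
            have : 3 * (Q + 1) ^ (s + 2) = 3 * (Q + 1) * (Q + 1) ^ (s + 1) := by ring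
            omega
        _ ≤ (8 * Q) * (Q + 1) ^ (s + 1) := Nat.mul_le_mul_right _ (by omega)
        _ = 8 * (Q + 1) ^ (s + 1) * Q := by ring
        _ ≤ ((n - 1) * (Q + 1) ^ (s + 1) + n * (Q + 1) ^ s) * Q := by
            refine Nat.mul_le_mul_right _ (le_add_right (Nat.mul_le_mul_right _ ?_))
            omega
  · subst hr2
    obtain ⟨rfl, rfl, h64⟩ := hsmall he
    have := charP_two_of_card_eq_two_pow (F := F) (k := 6) (by rw [h64]; norm_num)
    obtain ⟨w, hw⟩ := exists_sq_add_self_add_one_eq_zero (F := F) (by rw [h64]; norm_num)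
    rw [powSumCount_three_zero h64 hw] at hcone
    omega
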